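/- Let $G$ be a finite simple undirected graph with two vertices $s,t$. An \emph{$s$-$t$-separator} is a set $S\subseteq V(G)\setminus\{s,t\}$ such that $s$ and $t$ lie in different connected components of $G-S$; it is \emph{minimum} if it has the smallest size among all $s$-$t$-separators. A \emph{token jump} replaces a set $S$ by $(S\setminus\{v\})\cup\{u\}$ with $v\in S$ and $u\in V(G)\setminus S$. A minimum $s$-$t$-separator $A$ \emph{can be reconfigured} into a minimum $s$-$t$-separator $B$ by token jumps if there is a sequence $A=S_0,S_1,\dots,S_\ell=B$ with $\ell\ge 0$ in which every $S_i$ is a minimum $s$-$t$-separator and every $S_{i+1}$ arises from $S_i$ by one token jump. \textbf{Theorem.} There is a polynomial-time algorithm (a fixed program of a unit-cost random access machine with addition, subtraction and indirect addressing, whose number of steps is bounded by a polynomial in $n=|V(G)|$) that, given a graph $G$ on the vertex set $\{0,\dots,n-1\}$, vertices $s,t$, and two minimum $s$-$t$-separators $A$ and $B$, decides whether $A$ can be reconfigured into $B$ by token jumps and, if it can, outputs a (not necessarily shortest) sequence of token jumps $(v_0,u_0),\dots,(v_{\ell-1},u_{\ell-1})$ that reconfigures $A$ into $B$ through minimum $s$-$t$-separators.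 -/

import Mathlib

/-! ## Minimum separators and token jumps -/

/-- `S` is an `s`-`t`-separator of `G`: the vertices `s` and `t` both survive in `G - S` and lie in
different connected components of `G - S`. -/
def IsSeparator {V : Type*} (G : SimpleGraph V) (s t : V) (S : Finset V) : Prop :=
  ∃ (hs : s ∈ ((S : Set V)ᶜ)) (ht : t ∈ ((S : Set V)ᶜ)),
    ¬ (G.induce ((S : Set V)ᶜ)).Reachable ⟨s, hs⟩ ⟨t, ht⟩

/-- `S` is an `s`-`t`-separator of minimum size. -/
def IsMinSeparator {V : Type*} (G : SimpleGraph V) (s t : V) (S : Finset V) : Prop :=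
  IsSeparator G s t S ∧ ∀ S' : Finset V, IsSeparator G s t S' → S.card ≤ S'.card

/-- `S'` arises from `S` by letting the token on `v ∈ S` jump to the vertex `u ∉ S`. -/
def IsTokenJump {V : Type*} [DecidableEq V] (S : Finset V) (v u : V) (S' : Finset V) : Prop :=
  v ∈ S ∧ u ∉ S ∧ S' = (S \ {v}) ∪ {u}

/-- `S 0, S 1, …, S l` is a token jumping reconfiguration sequence, with `l` jumps, from `A` to `B`:
all its members are minimum `s`-`t`-separators and each one arises from the previous one by one
token jump (the values `S i` for `i > l` are irrelevant). -/
def IsJumpSequence {V : Type*} [DecidableEq V] (G : SimpleGraph V) (s t : V) (A B : Finset V)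
    (l : ℕ) (S : ℕ → Finset V) : Prop :=
  S 0 = A ∧ S l = B ∧ (∀ i ≤ l, IsMinSeparator G s t (S i)) ∧
    ∀ i < l, ∃ v u : V, IsTokenJump (S i) v u (S (i + 1))

/-- `A` can be reconfigured into `B` by token jumps. -/
def JumpReconfigurable {V : Type*} [DecidableEq V] (G : SimpleGraph V) (s t : V)
    (A B : Finset V) : Prop :=
  ∃ (l : ℕ) (S : ℕ → Finset V), IsJumpSequence G s t A B l S

/-! ## Random access machines

The machine has registers and arrays of unbounded length, all holding natural numbers. A program is
a fixed finite text, so it names only finitely many registers and arrays. Its arithmetic consists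
of addition and truncated subtraction only; under the unit-cost measure, this model is polynomially
equivalent to Turing machines. -/

namespace RAM

/-- A memory state: register `i` holds `reg i`, cell `j` of array `a` holds `arr a j`. -/
@[ext]
structure State where
  reg : ℕ → ℕ
  arr : ℕ → ℕ → ℕ

/-- Expressions: constants, registers, array cells with a computed index, sums and truncated
differences. -/
inductive Expr : Type
  | const (c : ℕ) : Expr
  | reg (i : ℕ) : Expr
  | load (a : ℕ) (e : Expr) : Expr
  | add (e f : Expr) : Expr
  | sub (e f : Expr) : Expr

/-- The value of an expression in a memory state. -/
def Expr.eval (m : State) : Expr → ℕ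
  | .const c => c
  | .reg i => m.reg i
  | .load a e => m.arr a (e.eval m)
  | .add e f => e.eval m + f.eval m
  | .sub e f => e.eval m - f.eval m

/-- The number of elementary operations that the evaluation of an expression takes. -/
def Expr.cost : Expr → ℕ
  | .const _ => 1
  | .reg _ => 1
  | .load _ e => e.cost + 1
  | .add e f => e.cost + f.cost + 1
  | .sub e f => e.cost + f.cost + 1

/-- Programs. A test expression counts as true when its value is not `0`. -/
inductive Program : Type
  | skip : Program
  | assign (i : ℕ) (e : Expr) : Program
  | store (a : ℕ) (e f : Expr) : Program
  | seq (P Q : Program) : Program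
  | branch (e : Expr) (P Q : Program) : Program
  | loop (e : Expr) (P : Program) : Program

/-- Write the number `x` into register `i`. -/
def State.setReg (m : State) (i x : ℕ) : State :=
  { m with reg := Function.update m.reg i x }

/-- Write the number `x` into cell `j` of array `a`. -/
def State.setArr (m : State) (a j x : ℕ) : State :=
  { m with arr := Function.update m.arr a (Function.update (m.arr a) j x) }

/-- `Run P m T m'`: the program `P`, started in the memory state `m`, halts after exactly `T` steps
in the memory state `m'`. `assign i e` writes `e` into register `i`, `store a e f` writes `f` into
cell `e` of array `a`, `branch e P Q` is "if `e` then `P` else `Q`", and `loop e P` is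
"while `e` do `P`". -/
inductive Run : Program → State → ℕ → State → Prop
  | skip (m : State) : Run .skip m 1 m
  | assign (m : State) (i : ℕ) (e : Expr) :
      Run (.assign i e) m (e.cost + 1) (m.setReg i (e.eval m))
  | store (m : State) (a : ℕ) (e f : Expr) :
      Run (.store a e f) m (e.cost + f.cost + 1) (m.setArr a (e.eval m) (f.eval m))
  | seq {P Q : Program} {m₁ m₂ m₃ : State} {T₁ T₂ : ℕ} :
      Run P m₁ T₁ m₂ → Run Q m₂ T₂ m₃ → Run (.seq P Q) m₁ (T₁ + T₂) m₃
  | branch_true {e : Expr} {P Q : Program} {m m' : State} {T : ℕ} :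
      e.eval m ≠ 0 → Run P m T m' → Run (.branch e P Q) m (e.cost + 1 + T) m'
  | branch_false {e : Expr} {P Q : Program} {m m' : State} {T : ℕ} :
      e.eval m = 0 → Run Q m T m' → Run (.branch e P Q) m (e.cost + 1 + T) m'
  | loop_true {e : Expr} {P : Program} {m₁ m₂ m₃ : State} {T₁ T₂ : ℕ} :
      e.eval m₁ ≠ 0 → Run P m₁ T₁ m₂ → Run (.loop e P) m₂ T₂ m₃ →
        Run (.loop e P) m₁ (e.cost + 1 + T₁ + T₂) m₃
  | loop_false {e : Expr} {P : Program} {m : State} :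
      e.eval m = 0 → Run (.loop e P) m (e.cost + 1) m

/-- Programs are deterministic: number of steps and final state are determined by the initial
state. -/
theorem Run.deterministic {P : Program} {m m₁ m₂ : State} {T₁ T₂ : ℕ}
    (h₁ : Run P m T₁ m₁) (h₂ : Run P m T₂ m₂) : T₁ = T₂ ∧ m₁ = m₂ := by
  induction h₁ generalizing T₂ m₂ with
  | skip m => cases h₂; exact ⟨rfl, rfl⟩
  | assign m i e => cases h₂; exact ⟨rfl, rfl⟩
  | store m a e f => cases h₂; exact ⟨rfl, rfl⟩
  | seq _ _ ih₁ ih₂ =>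
    cases h₂ with
    | seq a b =>
      obtain ⟨rfl, rfl⟩ := ih₁ a
      obtain ⟨rfl, rfl⟩ := ih₂ b
      exact ⟨rfl, rfl⟩
  | branch_true h _ ih =>
    cases h₂ with
    | branch_true _ a => obtain ⟨rfl, rfl⟩ := ih a; exact ⟨rfl, rfl⟩
    | branch_false h' _ => exact absurd h' h
  | branch_false h _ ih =>
    cases h₂ with
    | branch_true h' _ => exact absurd h h'
    | branch_false _ a => obtain ⟨rfl, rfl⟩ := ih a; exact ⟨rfl, rfl⟩
  | loop_true h _ _ ih₁ ih₂ =>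
    cases h₂ with
    | loop_true _ a b =>
      obtain ⟨rfl, rfl⟩ := ih₁ a
      obtain ⟨rfl, rfl⟩ := ih₂ b
      exact ⟨rfl, rfl⟩
    | loop_false h' => exact absurd h' h
  | loop_false h =>
    cases h₂ with
    | loop_true h' _ _ => exact absurd h h'
    | loop_false _ => exact ⟨rfl, rfl⟩

end RAM

/-! ## Instances and answers as memory states -/

open scoped Classical in
/-- The instance `(G, s, t, A, B)` as an initial memory state: registers `0`, `1`, `2` hold `n`, `s`
and `t`, array `0` holds the adjacency matrix of `G` row by row, arrays `1` and `2` hold the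
characteristic vectors of `A` and `B`, and everything else is `0`. -/
noncomputable def instanceState {n : ℕ} (G : SimpleGraph (Fin n)) (s t : Fin n)
    (A B : Finset (Fin n)) : RAM.State where
  reg := fun i => if i = 0 then n else if i = 1 then (s : ℕ) else if i = 2 then (t : ℕ) else 0
  arr := fun a j =>
    if a = 0 then (if ∃ u v : Fin n, G.Adj u v ∧ j = (u : ℕ) * n + (v : ℕ) then 1 else 0)
    else if a = 1 then (if ∃ v ∈ A, j = (v : ℕ) then 1 else 0)
    else if a = 2 then (if ∃ v ∈ B, j = (v : ℕ) then 1 else 0)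
    else 0

/-- The memory state `m` says "yes" in register `0` and holds a token jumping reconfiguration
sequence from `A` to `B`: register `1` holds the number of jumps, and the `i`-th jump (counted
from `0`) moves the token on the vertex in cell `i` of array `3` to the vertex in cell `i` of
array `4`. -/
def AnswersYesWithWitness {n : ℕ} (G : SimpleGraph (Fin n)) (s t : Fin n) (A B : Finset (Fin n))
    (m : RAM.State) : Prop :=
  m.reg 0 = 1 ∧ ∃ S : ℕ → Finset (Fin n), IsJumpSequence G s t A B (m.reg 1) S ∧
    ∀ i < m.reg 1, ∃ v u : Fin n,
      m.arr 3 i = (v : ℕ) ∧ m.arr 4 i = (u : ℕ) ∧ IsTokenJump (S i) v u (S (i + 1))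

/-- The memory state `m` says "no" in register `0`. -/
def AnswersNo (m : RAM.State) : Prop := m.reg 0 = 0

/-!
The minimum separators of `G` form a lattice, in which `S ≤ S'` means that the side of `s` in
`G - S` is contained in the one in `G - S'`: by submodularity of the outer boundary, the boundary
of the union of the two sides is a minimum separator again. Starting from `A`, jump greedily
upwards. Each such jump enlarges the side of `s`, so that fewer than `n` of them are possible. Let
`M` be the set in which no upward jump is left. Then everything reconfigurable from `A` lies below
`M`: if `S ≤ M` and a jump leads from `S` to `S'`, then the join of `M` and `S'` has at most one
vertex outside of `M`, and so it equals `M`, since otherwise an upward jump would lead from `M` to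
it. Hence `A` can be reconfigured into `B` if and only if the ascents from `A` and from `B` end in
the same set, and then the first ascent followed by the reverse of the second one leads from `A`
to `B`.
-/

section SourceSide

variable {V : Type*} {G : SimpleGraph V} {s x y : V} {S T X Y : Set V}

/-- The vertices on the side of `s` in `G - S`. Only the vertices after the first one of a walk are
required to avoid `S`, so `s` itself always belongs to its side. -/
def sourceSide (G : SimpleGraph V) (s : V) (S : Set V) : Set V :=
  {y | Relation.ReflTransGen (fun x y => G.Adj x y ∧ y ∉ S) s y}

/-- The outer vertex boundary of `X`: the vertices outside of `X` with a neighbour in `X`. -/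
def outerBoundary (G : SimpleGraph V) (X : Set V) : Set V :=
  {y | y ∉ X ∧ ∃ x ∈ X, G.Adj x y}

theorem self_mem_sourceSide : s ∈ sourceSide G s S := .refl

theorem mem_sourceSide_of_adj (hx : x ∈ sourceSide G s S) (hxy : G.Adj x y) (hy : y ∉ S) :
    y ∈ sourceSide G s S :=
  hx.tail ⟨hxy, hy⟩

theorem sourceSide_subset_of_closed (hs : s ∈ X)
    (hX : ∀ x ∈ X, ∀ y, G.Adj x y → y ∉ S → y ∈ X) : sourceSide G s S ⊆ X := by
  intro y hy
  induction hy with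
  | refl => exact hs
  | tail _ hxy hx => exact hX _ hx _ hxy.1 hxy.2

theorem sourceSide_subset_of_outerBoundary_subset (hs : s ∈ X) (hX : outerBoundary G X ⊆ S) :
    sourceSide G s S ⊆ X :=
  sourceSide_subset_of_closed hs fun x hx _ hxy hy =>
    by_contra fun hyX => hy (hX ⟨hyX, x, hx, hxy⟩)

theorem sourceSide_subset_sourceSide_of_disjoint (h : Disjoint (sourceSide G s S) T) :
    sourceSide G s S ⊆ sourceSide G s T := by
  intro y hy
  induction hy with
  | refl => exact self_mem_sourceSide
  | tail hx hxy ih => exact mem_sourceSide_of_adj ih hxy.1 (Set.disjoint_left.1 h (hx.tail hxy))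

theorem disjoint_sourceSide (hs : s ∉ S) : Disjoint (sourceSide G s S) S := by
  refine Set.disjoint_left.2 fun y hy => ?_
  rcases Relation.ReflTransGen.cases_tail hy with rfl | ⟨_, _, hxy⟩
  exacts [hs, hxy.2]

theorem disjoint_outerBoundary : Disjoint X (outerBoundary G X) :=
  Set.disjoint_right.2 fun _ hy => hy.1

theorem outerBoundary_sourceSide_subset : outerBoundary G (sourceSide G s S) ⊆ S :=
  fun _ ⟨hy, _, hx, hxy⟩ => by_contra fun hyS => hy (mem_sourceSide_of_adj hx hxy hyS)

theorem sourceSide_subset_sourceSide_outerBoundary (h : sourceSide G s S ⊆ X) :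
    sourceSide G s S ⊆ sourceSide G s (outerBoundary G X) :=
  sourceSide_subset_sourceSide_of_disjoint (disjoint_outerBoundary.mono_left h)

theorem outerBoundary_union_subset :
    outerBoundary G (X ∪ Y) ⊆ outerBoundary G X ∪ outerBoundary G Y := by
  rintro y ⟨hy, x, hx | hx, hxy⟩
  · exact .inl ⟨fun h => hy (.inl h), x, hx, hxy⟩
  · exact .inr ⟨fun h => hy (.inr h), x, hx, hxy⟩

theorem outerBoundary_inter_subset :
    outerBoundary G (X ∩ Y) ⊆ outerBoundary G X ∪ outerBoundary G Y := by
  rintro y ⟨hy, x, ⟨hxX, hxY⟩, hxy⟩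
  by_cases hyX : y ∈ X
  · exact .inr ⟨fun hyY => hy ⟨hyX, hyY⟩, x, hxY, hxy⟩
  · exact .inl ⟨hyX, x, hxX, hxy⟩

theorem encard_outerBoundary_union_add_inter_le :
    (outerBoundary G (X ∪ Y)).encard + (outerBoundary G (X ∩ Y)).encard ≤
      (outerBoundary G X).encard + (outerBoundary G Y).encard := by
  rw [← Set.encard_union_add_encard_inter,
    ← Set.encard_union_add_encard_inter (outerBoundary G X)]
  refine add_le_add
    (Set.encard_le_encard (Set.union_subset outerBoundary_union_subset outerBoundary_inter_subset))
    (Set.encard_le_encard ?_)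
  rintro y ⟨⟨hy, -⟩, -, x, ⟨hxX, hxY⟩, hxy⟩
  exact ⟨⟨fun h => hy (.inl h), x, hxX, hxy⟩, ⟨fun h => hy (.inr h), x, hxY, hxy⟩⟩

end SourceSide

section MinSeparator

variable {V : Type*} {G : SimpleGraph V} {s t v : V} {S S' M N : Finset V} {X : Set V}

theorem mem_sourceSide_iff_reachable {S : Set V} {y : V} (hs : s ∈ Sᶜ) (hy : y ∈ Sᶜ) :
    y ∈ sourceSide G s S ↔ (G.induce Sᶜ).Reachable ⟨s, hs⟩ ⟨y, hy⟩ := by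
  constructor
  · intro h
    induction h with
    | refl => exact .refl _
    | @tail x _ hx hxy ih =>
      exact (ih (Set.disjoint_left.1 (disjoint_sourceSide hs) hx)).trans
        (SimpleGraph.Adj.reachable hxy.1)
  · exact fun h => ((SimpleGraph.reachable_iff_reflTransGen _ _).1 h).lift Subtype.val
      fun _ y hxy => ⟨hxy, y.2⟩

theorem isSeparator_iff : IsSeparator G s t S ↔ s ∉ S ∧ t ∉ S ∧ t ∉ sourceSide G s S := by
  constructor
  · rintro ⟨hs, ht, h⟩
    exact ⟨hs, ht, fun h' => h ((mem_sourceSide_iff_reachable hs ht).1 h')⟩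
  · rintro ⟨hs, ht, h⟩
    exact ⟨hs, ht, fun h' => h ((mem_sourceSide_iff_reachable hs ht).2 h')⟩

theorem IsSeparator.source_notMem (h : IsSeparator G s t S) : s ∉ S := (isSeparator_iff.1 h).1

theorem IsSeparator.sink_notMem (h : IsSeparator G s t S) : t ∉ S := (isSeparator_iff.1 h).2.1

theorem IsSeparator.sink_notMem_sourceSide (h : IsSeparator G s t S) : t ∉ sourceSide G s S :=
  (isSeparator_iff.1 h).2.2

theorem exists_isSeparator_coe_eq_outerBoundary (hs : s ∈ X) (ht : t ∉ X)
    (htX : t ∉ outerBoundary G X) (hX : (outerBoundary G X).Finite) :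
    ∃ N : Finset V, IsSeparator G s t N ∧ (N : Set V) = outerBoundary G X := by
  obtain ⟨N, hN⟩ := hX.exists_finset_coe
  have hNX : ∀ y ∈ N, y ∈ outerBoundary G X := fun _ hy => hN.subset hy
  exact ⟨N, isSeparator_iff.2 ⟨fun h => (hNX s h).1 hs, fun h => htX (hNX t h),
    fun h => ht (sourceSide_subset_of_outerBoundary_subset hs hN.superset h)⟩, hN⟩

theorem IsMinSeparator.of_card_le (hS : IsMinSeparator G s t S) (hS' : IsSeparator G s t S')
    (h : S'.card ≤ S.card) : IsMinSeparator G s t S' :=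
  ⟨hS', fun T hT => h.trans (hS.2 T hT)⟩

theorem IsMinSeparator.card_eq (hS : IsMinSeparator G s t S) (hS' : IsMinSeparator G s t S') :
    S.card = S'.card :=
  (hS.2 _ hS'.1).antisymm (hS'.2 _ hS.1)

theorem IsMinSeparator.outerBoundary_sourceSide (hS : IsMinSeparator G s t S) :
    outerBoundary G (sourceSide G s S) = S := by
  have hsub : outerBoundary G (sourceSide G s S) ⊆ S := outerBoundary_sourceSide_subset
  obtain ⟨N, hN, hNS⟩ := exists_isSeparator_coe_eq_outerBoundary self_mem_sourceSide
    hS.1.sink_notMem_sourceSide (fun h => hS.1.sink_notMem (hsub h)) (S.finite_toSet.subset hsub)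
  rw [← hNS, Finset.coe_subset] at hsub
  rw [← hNS, Finset.eq_of_subset_of_card_le hsub (hS.2 N hN)]

theorem IsMinSeparator.eq_of_sourceSide_eq (hS : IsMinSeparator G s t S)
    (hS' : IsMinSeparator G s t S') (h : sourceSide G s S = sourceSide G s S') : S = S' := by
  rw [← Finset.coe_inj, ← hS.outerBoundary_sourceSide, h, hS'.outerBoundary_sourceSide]

/-- The boundaries of the union and of the intersection of the two sides are separators, so
submodularity of the boundary forces both of them to be minimum. -/
theorem IsMinSeparator.exists_join (hS : IsMinSeparator G s t S) (hS' : IsMinSeparator G s t S') :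
    ∃ N : Finset V, IsMinSeparator G s t N ∧
      (N : Set V) = outerBoundary G (sourceSide G s S ∪ sourceSide G s S') := by
  have hfin : ((S : Set V) ∪ S').Finite := S.finite_toSet.union S'.finite_toSet
  have hunion := outerBoundary_union_subset (G := G) (X := sourceSide G s S)
    (Y := sourceSide G s S')
  have hinter := outerBoundary_inter_subset (G := G) (X := sourceSide G s S)
    (Y := sourceSide G s S')
  have hcard := encard_outerBoundary_union_add_inter_le (G := G) (X := sourceSide G s S)
    (Y := sourceSide G s S')
  rw [hS.outerBoundary_sourceSide, hS'.outerBoundary_sourceSide] at hunion hinter hcard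
  have ht : t ∉ (S : Set V) ∪ S' := not_or.2 ⟨hS.1.sink_notMem, hS'.1.sink_notMem⟩
  obtain ⟨N, hN, hN_eq⟩ := exists_isSeparator_coe_eq_outerBoundary (t := t)
    (Set.mem_union_left _ self_mem_sourceSide)
    (not_or.2 ⟨hS.1.sink_notMem_sourceSide, hS'.1.sink_notMem_sourceSide⟩)
    (fun h => ht (hunion h)) (hfin.subset hunion)
  obtain ⟨N', hN', hN'_eq⟩ := exists_isSeparator_coe_eq_outerBoundary (t := t)
    (Set.mem_inter self_mem_sourceSide self_mem_sourceSide)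
    (fun h => hS.1.sink_notMem_sourceSide h.1)
    (fun h => ht (hinter h)) (hfin.subset hinter)
  refine ⟨N, hS.of_card_le hN ?_, hN_eq⟩
  simp only [← hN_eq, ← hN'_eq, Set.encard_coe_eq_coe_finsetCard] at hcard
  norm_cast at hcard
  have := hS'.2 _ hN'
  omega

theorem IsMinSeparator.mem_sourceSide_of_notMem_join (hM : IsMinSeparator G s t M)
    (hN : (N : Set V) = outerBoundary G (sourceSide G s M ∪ sourceSide G s S)) (hvM : v ∈ M)
    (hvN : v ∉ N) : v ∈ sourceSide G s N := by
  rw [← Finset.mem_coe, hN] at hvN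
  rw [hN]
  rw [← Finset.mem_coe, ← hM.outerBoundary_sourceSide] at hvM
  obtain ⟨-, x, hx, hxv⟩ := hvM
  exact mem_sourceSide_of_adj
    (sourceSide_subset_sourceSide_outerBoundary Set.subset_union_left hx) hxv hvN

end MinSeparator

section TokenJump

variable {V : Type*} [DecidableEq V] {G : SimpleGraph V} {s t : V} {S S' M N A B : Finset V}
  {u v : V}

/-- The set that arises from `S` when the token on `v` jumps to `u`. -/
def jump (S : Finset V) (v u : V) : Finset V := (S \ {v}) ∪ {u}

theorem jump_eq_insert_erase : jump S v u = insert u (S.erase v) := by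
  rw [jump, Finset.sdiff_singleton_eq_erase, Finset.union_comm, ← Finset.insert_eq]

theorem jump_jump (hv : v ∈ S) (hu : u ∉ S) : jump (jump S v u) u v = S := by
  rw [jump_eq_insert_erase, jump_eq_insert_erase,
    Finset.erase_insert fun h => hu (Finset.mem_of_mem_erase h), Finset.insert_erase hv]

theorem isTokenJump_jump (hv : v ∈ S) (hu : u ∉ S) : IsTokenJump S v u (jump S v u) :=
  ⟨hv, hu, rfl⟩

theorem IsTokenJump.eq_jump (h : IsTokenJump S v u S') : S' = jump S v u := h.2.2

theorem IsTokenJump.card_eq (h : IsTokenJump S v u S') : S'.card = S.card := by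
  obtain ⟨hv, hu, -⟩ := id h
  rw [h.eq_jump, jump_eq_insert_erase,
    Finset.card_insert_of_notMem fun h => hu (Finset.mem_of_mem_erase h),
    Finset.card_erase_add_one hv]

theorem IsTokenJump.symm (h : IsTokenJump S v u S') : IsTokenJump S' u v S := by
  obtain ⟨hv, hu, -⟩ := id h
  have hvu : v ≠ u := fun e => hu (e ▸ hv)
  rw [h.eq_jump]
  exact ⟨by simp [jump], by simp [jump, hvu], (jump_jump hv hu).symm⟩

theorem exists_isTokenJump_of_subset_insert (hsub : N ⊆ insert u M) (hcard : N.card = M.card)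
    (hne : N ≠ M) : ∃ v, IsTokenJump M v u N := by
  obtain ⟨v, hvM, hvN⟩ := Finset.not_subset.1 fun h =>
    hne (Finset.eq_of_subset_of_card_le h hcard.le).symm
  have huM : u ∉ M := fun hu => hne <|
    Finset.eq_of_subset_of_card_le (by rwa [Finset.insert_eq_of_mem hu] at hsub) hcard.ge
  have hjump := isTokenJump_jump hvM huM
  refine ⟨v, hvM, huM, Finset.eq_of_subset_of_card_le (fun x hx => ?_)
    (hjump.card_eq.trans hcard.symm).le⟩
  have hxv : x ≠ v := fun e => hvN (e ▸ hx)
  have := hsub hx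
  grind

theorem JumpReconfigurable.symm (h : JumpReconfigurable G s t A B) :
    JumpReconfigurable G s t B A := by
  obtain ⟨l, S, rfl, rfl, hmin, hjump⟩ := h
  refine ⟨l, fun i => S (l - i), by simp, by simp, fun i _ => hmin _ (by omega), fun i hi => ?_⟩
  obtain ⟨v, u, h⟩ := hjump (l - (i + 1)) (by omega)
  rw [show l - (i + 1) + 1 = l - i by omega] at h
  exact ⟨u, v, h.symm⟩

theorem JumpReconfigurable.isMinSeparator_right (h : JumpReconfigurable G s t A B) :
    IsMinSeparator G s t B := by
  obtain ⟨l, S, -, rfl, hmin, -⟩ := h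
  exact hmin l le_rfl

/-- The token on `v` can jump to `u` in such a way that the result separates `s` from `t` and `v`
falls on the side of `s`. Such jumps lead upwards in the lattice of minimum separators. -/
def IsUpJump (G : SimpleGraph V) (s t : V) (S : Finset V) (v u : V) : Prop :=
  IsTokenJump S v u (jump S v u) ∧ IsSeparator G s t (jump S v u) ∧
    v ∈ sourceSide G s (jump S v u)

theorem isUpJump_iff (hS : IsSeparator G s t S) :
    IsUpJump G s t S v u ↔ ((v ∈ S ∧ u ∉ S) ∧ u ≠ s ∧ u ≠ t) ∧
      v ∈ sourceSide G s (jump S v u) ∧ t ∉ sourceSide G s (jump S v u) := by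
  have hs := hS.source_notMem
  have ht := hS.sink_notMem
  have : s ∉ jump S v u ↔ u ≠ s := by simp [jump, hs, eq_comm]
  have : t ∉ jump S v u ↔ u ≠ t := by simp [jump, ht, eq_comm]
  have : IsTokenJump S v u (jump S v u) ↔ v ∈ S ∧ u ∉ S :=
    ⟨fun h => ⟨h.1, h.2.1⟩, fun h => isTokenJump_jump h.1 h.2⟩
  simp only [IsUpJump, isSeparator_iff]
  tauto

theorem IsUpJump.isMinSeparator (h : IsUpJump G s t S v u) (hS : IsMinSeparator G s t S) :
    IsMinSeparator G s t (jump S v u) :=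
  hS.of_card_le h.2.1 h.1.card_eq.le

theorem IsUpJump.target_notMem_sourceSide (h : IsUpJump G s t S v u)
    (hS : IsMinSeparator G s t S) : u ∉ sourceSide G s S := by
  obtain ⟨⟨hvS, -⟩, -, hv⟩ := id h
  intro hu
  obtain ⟨N, hN, hN_eq⟩ := hS.exists_join (h.isMinSeparator hS)
  suffices hsub : N ⊆ S.erase v from
    ((Finset.card_le_card hsub).trans_lt (Finset.card_erase_lt_of_mem hvS)).not_ge (hS.2 N hN.1)
  intro y hy
  rw [← Finset.mem_coe, hN_eq] at hy
  obtain ⟨hyS, hyJ⟩ := not_or.1 hy.1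
  have hyv : y ≠ v := fun e => hyJ (e ▸ hv)
  have hyu : y ≠ u := fun e => hyS (e ▸ hu)
  rcases outerBoundary_union_subset hy with hy | hy
  · exact Finset.mem_erase.2 ⟨hyv, outerBoundary_sourceSide_subset hy⟩
  · have hyjump : y ∈ jump S v u := outerBoundary_sourceSide_subset hy
    rw [jump_eq_insert_erase] at hyjump
    exact Finset.mem_of_mem_insert_of_ne hyjump hyu

theorem IsUpJump.sourceSide_ssubset (h : IsUpJump G s t S v u) (hS : IsMinSeparator G s t S) :
    sourceSide G s S ⊂ sourceSide G s (jump S v u) := by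
  have hdisj : Disjoint (sourceSide G s S) S := disjoint_sourceSide hS.1.source_notMem
  have hdisj' : Disjoint (sourceSide G s S) (jump S v u) := by
    rw [jump, Finset.coe_union, Finset.coe_sdiff, Finset.coe_singleton, Finset.coe_singleton]
    exact (hdisj.mono_right Set.sdiff_subset).union_right
      (Set.disjoint_singleton_right.2 (h.target_notMem_sourceSide hS))
  exact (Set.ssubset_iff_of_subset (sourceSide_subset_sourceSide_of_disjoint hdisj')).2
    ⟨v, h.2.2, Set.disjoint_right.1 hdisj h.1.1⟩

/-- No jump leads upwards from `M`. -/
def IsStuck (G : SimpleGraph V) (s t : V) (M : Finset V) : Prop :=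
  ∀ v u, ¬ IsUpJump G s t M v u

theorem IsTokenJump.join_subset_insert (hjump : IsTokenJump S v u S')
    (hS : IsMinSeparator G s t S) (hSM : sourceSide G s S ⊆ sourceSide G s M)
    (hN : (N : Set V) = outerBoundary G (sourceSide G s M ∪ sourceSide G s S')) :
    N ⊆ insert u M := by
  intro y hyN
  rw [← Finset.mem_coe, hN] at hyN
  rw [Finset.mem_insert, or_iff_not_imp_left]
  intro hyu
  rcases outerBoundary_union_subset hyN with hy | hy
  · exact outerBoundary_sourceSide_subset hy
  have hyS' : y ∈ S' := outerBoundary_sourceSide_subset hy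
  have hyS : y ∈ (S : Set V) := by
    rw [hjump.eq_jump, jump_eq_insert_erase] at hyS'
    exact Finset.mem_of_mem_erase (Finset.mem_of_mem_insert_of_ne hyS' hyu)
  rw [← hS.outerBoundary_sourceSide] at hyS
  obtain ⟨-, x, hx, hxy⟩ := hyS
  exact outerBoundary_sourceSide_subset ⟨fun h => hyN.1 (.inl h), x, hSM hx, hxy⟩

/-- The join of `M` and `S'` contains at most one vertex outside of `M`, so it is `M` itself or
arises from `M` by an upward jump. -/
theorem IsStuck.sourceSide_subset_of_isTokenJump (hstuck : IsStuck G s t M)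
    (hM : IsMinSeparator G s t M) (hS : IsMinSeparator G s t S) (hS' : IsMinSeparator G s t S')
    (hjump : IsTokenJump S v u S') (hSM : sourceSide G s S ⊆ sourceSide G s M) :
    sourceSide G s S' ⊆ sourceSide G s M := by
  obtain ⟨N, hN, hN_eq⟩ := hM.exists_join hS'
  have hS'N : sourceSide G s S' ⊆ sourceSide G s N :=
    hN_eq ▸ sourceSide_subset_sourceSide_outerBoundary Set.subset_union_right
  by_cases hNM : N = M
  · exact hNM ▸ hS'N
  obtain ⟨w, hw⟩ := exists_isTokenJump_of_subset_insert
    (hjump.join_subset_insert hS hSM hN_eq) (hN.card_eq hM) hNM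
  have hwN : w ∉ N := hw.symm.2.1
  have hup := hM.mem_sourceSide_of_notMem_join hN_eq hw.1 hwN
  obtain rfl := hw.eq_jump
  exact absurd ⟨hw, hN.1, hup⟩ (hstuck w u)

theorem IsStuck.sourceSide_subset (hstuck : IsStuck G s t M) (hM : IsMinSeparator G s t M)
    (hAM : sourceSide G s A ⊆ sourceSide G s M) (hAB : JumpReconfigurable G s t A B) :
    sourceSide G s B ⊆ sourceSide G s M := by
  obtain ⟨l, S, rfl, rfl, hmin, hjump⟩ := hAB
  suffices ∀ i ≤ l, sourceSide G s (S i) ⊆ sourceSide G s M from this l le_rfl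
  intro i
  induction i with
  | zero => exact fun _ => hAM
  | succ i ih =>
    intro hi
    obtain ⟨v, u, hj⟩ := hjump i hi
    exact hstuck.sourceSide_subset_of_isTokenJump hM (hmin i (by omega)) (hmin _ hi) hj
      (ih (by omega))

/-- `M` is where a greedy ascent from `A` ends. -/
structure IsSummit (G : SimpleGraph V) (s t : V) (A M : Finset V) : Prop where
  reconfigurable : JumpReconfigurable G s t A M
  subset : sourceSide G s A ⊆ sourceSide G s M
  isStuck : IsStuck G s t M

theorem IsSummit.sourceSide_subset (hM : IsSummit G s t A M) (hN : IsSummit G s t B N)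
    (h : JumpReconfigurable G s t A B) : sourceSide G s N ⊆ sourceSide G s M :=
  have hMmin := hM.reconfigurable.isMinSeparator_right
  hM.isStuck.sourceSide_subset hMmin (hM.isStuck.sourceSide_subset hMmin hM.subset h)
    hN.reconfigurable

theorem IsSummit.eq_of_jumpReconfigurable (hM : IsSummit G s t A M) (hN : IsSummit G s t B N)
    (h : JumpReconfigurable G s t A B) : M = N :=
  hM.reconfigurable.isMinSeparator_right.eq_of_sourceSide_eq hN.reconfigurable.isMinSeparator_right
    ((hN.sourceSide_subset hM h.symm).antisymm (hM.sourceSide_subset hN h))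

end TokenJump

namespace RAM

section Frame

variable {P Q : Program} {m m' m'' : State} {a i j T x : ℕ}

/-- Register `i` is the target of an assignment in the program. -/
def Program.WritesReg : Program → ℕ → Prop
  | .skip, _ => False
  | .assign j _, i => i = j
  | .store .., _ => False
  | .seq P Q, i => P.WritesReg i ∨ Q.WritesReg i
  | .branch _ P Q, i => P.WritesReg i ∨ Q.WritesReg i
  | .loop _ P, i => P.WritesReg i

/-- Array `a` is the target of a store in the program. -/
def Program.WritesArr : Program → ℕ → Prop
  | .skip, _ => False
  | .assign .., _ => False
  | .store b .., a => a = b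
  | .seq P Q, a => P.WritesArr a ∨ Q.WritesArr a
  | .branch _ P Q, a => P.WritesArr a ∨ Q.WritesArr a
  | .loop _ P, a => P.WritesArr a

/-- The states `m` and `m'` agree on all registers and arrays that `P` does not write to. -/
structure Program.Frame (P : Program) (m m' : State) : Prop where
  reg : ∀ {i}, ¬ P.WritesReg i → m'.reg i = m.reg i
  arr : ∀ {a}, ¬ P.WritesArr a → m'.arr a = m.arr a

@[simp] theorem State.setReg_reg_self : (m.setReg i x).reg i = x := Function.update_self ..

@[simp] theorem State.setReg_reg_of_ne (h : j ≠ i) : (m.setReg i x).reg j = m.reg j :=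
  Function.update_of_ne h ..

@[simp] theorem State.setReg_arr : (m.setReg i x).arr = m.arr := rfl

@[simp] theorem State.setArr_reg : (m.setArr a j x).reg = m.reg := rfl

@[simp] theorem State.setArr_arr_self :
    (m.setArr a j x).arr a = Function.update (m.arr a) j x :=
  Function.update_self ..

@[simp] theorem State.setArr_arr_of_ne {b : ℕ} (h : b ≠ a) :
    (m.setArr a j x).arr b = m.arr b :=
  Function.update_of_ne h ..

theorem Program.Frame.refl : P.Frame m m := ⟨fun _ => rfl, fun _ => rfl⟩

theorem Program.Frame.trans (h : P.Frame m m') (h' : P.Frame m' m'') : P.Frame m m'' :=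
  ⟨fun hi => (h'.reg hi).trans (h.reg hi), fun ha => (h'.arr ha).trans (h.arr ha)⟩

theorem Program.Frame.mono (h : P.Frame m m') (hreg : ∀ i, P.WritesReg i → Q.WritesReg i)
    (harr : ∀ a, P.WritesArr a → Q.WritesArr a) : Q.Frame m m' :=
  ⟨fun hi => h.reg (mt (hreg _) hi), fun ha => h.arr (mt (harr _) ha)⟩

theorem Program.Frame.seq_left (h : P.Frame m m') : (P.seq Q).Frame m m' :=
  h.mono (fun _ => Or.inl) fun _ => Or.inl

theorem Program.Frame.seq_right (h : Q.Frame m m') : (P.seq Q).Frame m m' :=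
  h.mono (fun _ => Or.inr) fun _ => Or.inr

theorem Program.frame_setReg (hi : P.WritesReg i) : P.Frame m (m.setReg i x) :=
  ⟨fun hj => State.setReg_reg_of_ne fun h => hj (h ▸ hi), fun _ => rfl⟩

theorem Program.frame_setArr (ha : P.WritesArr a) : P.Frame m (m.setArr a j x) :=
  ⟨fun _ => rfl, fun hb => State.setArr_arr_of_ne fun h => hb (h ▸ ha)⟩

theorem Run.frame (h : Run P m T m') : P.Frame m m' := by
  induction h with
  | skip | loop_false => exact .refl
  | assign => exact Program.frame_setReg rfl
  | store => exact Program.frame_setArr rfl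
  | seq _ _ ih₁ ih₂ => exact ih₁.seq_left.trans ih₂.seq_right
  | branch_true _ _ ih => exact ih.mono (fun _ => Or.inl) fun _ => Or.inl
  | branch_false _ _ ih => exact ih.mono (fun _ => Or.inr) fun _ => Or.inr
  | @loop_true e P _ _ _ _ _ _ _ _ ih₁ ih₂ =>
    exact (ih₁.mono (Q := .loop e P) (fun _ => id) fun _ => id).trans ih₂

end Frame

section Halts

/-- Started in `m`, the program `P` halts after at most `b` steps in a state that satisfies `Q`. -/
def Halts (P : Program) (m : State) (b : ℕ) (Q : State → Prop) : Prop :=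
  ∃ (T : ℕ) (m' : State), Run P m T m' ∧ T ≤ b ∧ Q m'

variable {P P₁ P₂ : Program} {m : State} {a b b₁ b₂ i : ℕ} {Q Q' R : State → Prop} {e e' : Expr}

theorem Halts.mono (h : Halts P m b₁ Q) (hb : b₁ ≤ b₂) (hQ : ∀ m', Q m' → Q' m') :
    Halts P m b₂ Q' :=
  let ⟨T, m', hrun, hT, hm'⟩ := h
  ⟨T, m', hrun, hT.trans hb, hQ _ hm'⟩

theorem Halts.post (h : Halts P m b Q) (hQ : ∀ m', Q m' → Q' m') : Halts P m b Q' :=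
  h.mono le_rfl hQ

theorem Halts.and_frame (h : Halts P m b Q) : Halts P m b fun m' => P.Frame m m' ∧ Q m' :=
  let ⟨T, m', hrun, hT, hm'⟩ := h
  ⟨T, m', hrun, hT, hrun.frame, hm'⟩

theorem Halts.skip (h : Q m) : Halts .skip m 1 Q := ⟨_, _, .skip m, le_rfl, h⟩

theorem Halts.assign (h : Q (m.setReg i (e.eval m))) : Halts (.assign i e) m (e.cost + 1) Q :=
  ⟨_, _, .assign m i e, le_rfl, h⟩

theorem Halts.store (h : Q (m.setArr a (e.eval m) (e'.eval m))) :
    Halts (.store a e e') m (e.cost + e'.cost + 1) Q :=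
  ⟨_, _, .store m a e e', le_rfl, h⟩

theorem Halts.seq (h₁ : Halts P₁ m b₁ R) (h₂ : ∀ m', P₁.Frame m m' → R m' → Halts P₂ m' b₂ Q) :
    Halts (P₁.seq P₂) m (b₁ + b₂) Q :=
  let ⟨_, _, hrun₁, hT₁, hR⟩ := h₁
  let ⟨_, _, hrun₂, hT₂, hQ⟩ := h₂ _ hrun₁.frame hR
  ⟨_, _, .seq hrun₁ hrun₂, add_le_add hT₁ hT₂, hQ⟩

theorem Halts.assign_seq (h : Halts P (m.setReg i (e.eval m)) b Q) :
    Halts (.seq (.assign i e) P) m (e.cost + 1 + b) Q :=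
  .seq (R := (· = m.setReg i (e.eval m))) (.assign rfl) fun _ _ hm' => hm' ▸ h

theorem Halts.store_seq (h : Halts P (m.setArr a (e.eval m) (e'.eval m)) b Q) :
    Halts (.seq (.store a e e') P) m (e.cost + e'.cost + 1 + b) Q :=
  .seq (R := (· = m.setArr a (e.eval m) (e'.eval m))) (.store rfl) fun _ _ hm' => hm' ▸ h

theorem Halts.branch (h₁ : e.eval m ≠ 0 → Halts P₁ m b₁ Q) (h₂ : e.eval m = 0 → Halts P₂ m b₂ Q) :
    Halts (.branch e P₁ P₂) m (e.cost + 1 + (b₁ + b₂)) Q := by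
  by_cases he : e.eval m = 0
  · obtain ⟨T, m', hrun, hT, hQ⟩ := h₂ he
    exact ⟨_, _, .branch_false he hrun, by omega, hQ⟩
  · obtain ⟨T, m', hrun, hT, hQ⟩ := h₁ he
    exact ⟨_, _, .branch_true he hrun, by omega, hQ⟩

/-- The invariant carries the number of rounds that are still to come. -/
theorem Halts.loop (I : ℕ → State → Prop) (h₀ : ∀ m, I 0 m → e.eval m = 0)
    (h : ∀ k m, I (k + 1) m → e.eval m ≠ 0 ∧ Halts P m b (I k)) {k : ℕ} (hm : I k m) :
    Halts (.loop e P) m (k * (e.cost + 1 + b) + (e.cost + 1)) (I 0) := by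
  induction k generalizing m with
  | zero => exact ⟨_, _, .loop_false (h₀ m hm), by omega, hm⟩
  | succ k ih =>
    obtain ⟨he, T₁, m₁, hrun₁, hT₁, hm₁⟩ := h k m hm
    obtain ⟨T₂, m₂, hrun₂, hT₂, hm₂⟩ := ih hm₁
    refine ⟨_, _, .loop_true he hrun₁ hrun₂, ?_, hm₂⟩
    rw [add_mul, one_mul]
    omega

end Halts

section Macros

variable {P : Program} {m : State} {b c n : ℕ} {Q : State → Prop} {e f : Expr}

/-- Boolean negation. -/
def Expr.not (e : Expr) : Expr := .sub (.const 1) e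

/-- Boolean conjunction. -/
def Expr.and (e f : Expr) : Expr := .not (.add e.not f.not)

/-- The test for equality of two numbers. -/
def Expr.eq (e f : Expr) : Expr := .not (.add (.sub e f) (.sub f e))

/-- The test for equality of two truth values. -/
def Expr.iff (e f : Expr) : Expr := .eq e.not f.not

@[simp] theorem Expr.eval_not_eq_zero : e.not.eval m = 0 ↔ e.eval m ≠ 0 := by
  simp only [Expr.not, Expr.eval]
  omega

@[simp] theorem Expr.eval_and_eq_zero :
    (e.and f).eval m = 0 ↔ ¬ (e.eval m ≠ 0 ∧ f.eval m ≠ 0) := by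
  simp [Expr.and, Expr.eval, -not_and]

@[simp] theorem Expr.eval_eq_eq_zero : (e.eq f).eval m = 0 ↔ e.eval m ≠ f.eval m := by
  simp only [Expr.eq, Expr.eval_not_eq_zero, Expr.eval]
  omega

@[simp] theorem Expr.eval_iff_eq_zero :
    (e.iff f).eval m = 0 ↔ ¬ (e.eval m ≠ 0 ↔ f.eval m ≠ 0) := by
  simp only [Expr.iff, Expr.eval_eq_eq_zero, Expr.not, Expr.eval]
  omega

/-- The one-sided conditional. -/
def Program.when (e : Expr) (P : Program) : Program := .branch e P .skip

theorem Halts.when (h : e.eval m ≠ 0 → Halts P m b Q) (hskip : e.eval m = 0 → Q m) :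
    Halts (.when e P) m (e.cost + 1 + (b + 1)) Q :=
  .branch h fun he => .skip (hskip he)

/-- Run `P` with register `c` counting from `0` up to, excluding, the value of register `0`. -/
def Program.for (c : ℕ) (P : Program) : Program :=
  .seq (.assign c (.const 0)) <|
    .loop (.sub (.reg 0) (.reg c)) <| .seq P <| .assign c (.add (.reg c) (.const 1))

/-- A bound for the running time of a counting loop with `n` rounds of at most `b` steps. All
bounds are written over a semiring, so as to be read as numbers and as polynomials alike. -/
def forCost {R : Type*} [Semiring R] (n b : R) : R := n * (b + 8) + 6

theorem Program.Frame.for {m m' : State} (h : P.Frame m m') : (Program.for c P).Frame m m' :=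
  h.mono (fun _ hP => Or.inr (Or.inl hP)) fun _ hP => Or.inr (Or.inl hP)

theorem Halts.for (I : ℕ → State → Prop) (hc : c ≠ 0) (hPc : ¬ P.WritesReg c)
    (hP₀ : ¬ P.WritesReg 0) (hn : m.reg 0 = n) (hI : ∀ i m x, I i m → I i (m.setReg c x))
    (hm : I 0 m)
    (h : ∀ i < n, ∀ m', (Program.for c P).Frame m m' → m'.reg c = i → I i m' →
      Halts P m' b (I (i + 1))) :
    Halts (.for c P) m (forCost n b) (I n) := by
  have hfor₀ : ¬ (Program.for c P).WritesReg 0 := by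
    simp [Program.for, Program.WritesReg, hc.symm, hP₀]
  refine (Halts.assign_seq (Halts.loop (b := b + 4) (k := n) (fun k m' =>
    k ≤ n ∧ (Program.for c P).Frame m m' ∧ m'.reg c = n - k ∧ I (n - k) m')
    ?_ ?_ ?_)).mono ?_ fun m' hm' => hm'.2.2.2
  · rintro m' ⟨-, hF, hc', -⟩
    simp [Expr.eval, hF.reg hfor₀, hn, hc']
  · rintro k m' ⟨hk, hF, hc', hm'⟩
    refine ⟨by simp only [Expr.eval, hF.reg hfor₀, hn, hc']; omega,
      (h _ (by omega) m' hF hc' hm').seq fun m'' hP hm'' => .assign ?_⟩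
    rw [show n - (k + 1) + 1 = n - k by omega] at hm''
    refine ⟨by omega, (hF.trans hP.for).trans (Program.frame_setReg (.inl rfl)), ?_, hI _ _ _ hm''⟩
    simp only [State.setReg_reg_self, Expr.eval, hP.reg hPc, hc']
    omega
  · refine ⟨le_rfl, Program.frame_setReg (.inl rfl), by simp [Expr.eval], ?_⟩
    rw [Nat.sub_self]
    exact hI _ _ _ hm
  · simp only [Expr.cost, forCost]
    apply le_of_eq
    ring

end Macros

section Improve

variable {P : Program} {m : State} {b n z : ℕ}

theorem index_inj {x x' y y' : Fin n} (h : (x : ℕ) * n + y = x' * n + y') : x = x' ∧ y = y' := by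
  have hn : 0 < n := x.pos
  constructor <;> ext
  · have := congrArg (· / n) h
    simpa only [mul_comm _ n, Nat.mul_add_div hn, Nat.div_eq_of_lt y.2, Nat.div_eq_of_lt y'.2,
      add_zero] using this
  · have := congrArg (· % n) h
    simpa only [Nat.mul_add_mod', Nat.mod_eq_of_lt y.2, Nat.mod_eq_of_lt y'.2] using this

theorem index_lt (x y : Fin n) : (x : ℕ) * n + y < n * n := by
  have := Nat.mul_le_mul_right n (Nat.succ_le_of_lt x.2)
  rw [Nat.succ_mul] at this
  omega

/-- Run `P` for all pairs of numbers below the value `n` of register `0`: registers `z` and `z + 1`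
hold the pair `x`, `y`, and register `z + 2` holds its index `x * n + y`. -/
def Program.forPairs (z : ℕ) (P : Program) : Program :=
  .seq (.assign (z + 2) (.const 0)) <|
    .for z <| .for (z + 1) <| .seq P <| .assign (z + 2) (.add (.reg (z + 2)) (.const 1))

/-- A bound for the running time of `Program.forPairs`. -/
def forPairsCost {R : Type*} [Semiring R] (n b : R) : R := 2 + forCost n (forCost n (b + 4))

theorem Halts.forPairs (I : ℕ → State → Prop) (hz : z ≠ 0)
    (hP : ∀ i, z ≤ i → i ≤ z + 2 → ¬ P.WritesReg i) (hP₀ : ¬ P.WritesReg 0) (hn : m.reg 0 = n)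
    (hI : ∀ k m i x, z ≤ i → I k m → I k (m.setReg i x)) (hm : I 0 m)
    (h : ∀ (x y : Fin n) (m' : State), (Program.forPairs z P).Frame m m' → m'.reg z = x →
      m'.reg (z + 1) = y → m'.reg (z + 2) = x * n + y → I (x * n + y) m' →
      Halts P m' b (I (x * n + y + 1))) :
    Halts (.forPairs z P) m (forPairsCost n b) (I (n * n)) := by
  have hbody : ∀ i, (P.seq (.assign (z + 2) (.add (.reg (z + 2)) (.const 1)))).WritesReg i ↔
      P.WritesReg i ∨ i = z + 2 := fun i => Iff.rfl
  have hrow : ∀ i, (Program.for (z + 1) (P.seq (.assign (z + 2) (.add (.reg (z + 2))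
      (.const 1))))).WritesReg i ↔ i = z + 1 ∨ (P.WritesReg i ∨ i = z + 2) ∨ i = z + 1 :=
    fun i => Iff.rfl
  refine .assign_seq <| (Halts.for (fun x m' => I (x * n) m' ∧ m'.reg (z + 2) = x * n) hz
    (by simp [hrow, hP z]) (by simp [hrow, hP₀]) (by simp [hn]) ?_ ?_
    fun x hx m₁ hF₁ hx₁ hI₁ => ?_).post fun m' hm' => hm'.1
  · rintro k m' x ⟨hm', hidx⟩
    exact ⟨hI _ _ _ _ le_rfl hm', by simpa using hidx⟩
  · exact ⟨by simpa using hI _ _ _ _ (by simp) hm, by simp [Expr.eval]⟩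
  have hF₁' : (Program.forPairs z P).Frame m m₁ :=
    (Program.frame_setReg (P := .forPairs z P) (Or.inl rfl)).trans hF₁.seq_right
  have hn₁ : m₁.reg 0 = n := by
    rw [hF₁'.reg (by simp [Program.forPairs, Program.for, Program.WritesReg, hz.symm, hP₀]), hn]
  refine (Halts.for (fun y m' => I (x * n + y) m' ∧ m'.reg (z + 2) = x * n + y) (by simp)
    (by simp [hbody, hP (z + 1)]) (by simp [hbody, hP₀]) hn₁ ?_ hI₁
    fun y hy m₂ hF₂ hy₂ ⟨hI₂, hidx⟩ => ?_).post fun m' hm' => by rwa [Nat.succ_mul]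
  · rintro k m' y ⟨hm', hidx⟩
    exact ⟨hI _ _ _ _ (by simp) hm', by simpa using hidx⟩
  have hx₂ : m₂.reg z = x := by rw [hF₂.reg (by simp [hrow, hP z]), hx₁]
  refine (h ⟨x, hx⟩ ⟨y, hy⟩ m₂ (hF₁'.trans hF₂.for.seq_right) hx₂ hy₂ hidx hI₂).seq
    fun m₃ hF₃ hI₃ => .assign ⟨hI _ _ _ _ (by simp) hI₃, ?_⟩
  simp [Expr.eval, hF₃.reg (hP (z + 2) (by simp) le_rfl), hidx, add_assoc]

/-- Local search: `P` looks at a pair `x`, `y` of numbers below `n`, in registers `z + 1` and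
`z + 2`, and changes the state if the pair allows for an improvement. In each of `n` rounds, `P`
looks at all pairs. -/
def Program.improve (z : ℕ) (P : Program) : Program := .for z (.forPairs (z + 1) P)

/-- A bound for the running time of `Program.improve`. -/
def improveCost {R : Type*} [Semiring R] (n b : R) : R := forCost n (forPairsCost n b)

/-- What is known about the result `x` of a local search with potential `φ` after `k` complete
rounds and the first `i` pairs of the next one. -/
def SearchProgress {σ : Type*} (φ : σ → ℕ) (Imp : σ → Fin n → Fin n → Prop) (k i : ℕ) (x : σ) :
    Prop :=
  (∀ u v, ¬ Imp x u v) ∨ k + 1 < φ x ∨ k < φ x ∧ ∀ u v : Fin n, u * n + v < i → ¬ Imp x u v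

section

variable {σ : Type*} {φ : σ → ℕ} {Imp : σ → Fin n → Fin n → Prop} {k i : ℕ} {x x' : σ}
  {u v : Fin n}

theorem SearchProgress.next_round (h : SearchProgress φ Imp k (n * n) x) :
    SearchProgress φ Imp (k + 1) 0 x := by
  rcases h with h | h | ⟨-, h⟩
  · exact .inl h
  · exact .inr (.inr ⟨h, by simp⟩)
  · exact .inl fun u v => h u v (index_lt u v)

theorem SearchProgress.of_lt (h : SearchProgress φ Imp k i x) (huv : Imp x u v)
    (hx' : φ x < φ x') (j : ℕ) : SearchProgress φ Imp k j x' := by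
  rcases h with h | h | ⟨h, -⟩
  · exact absurd huv (h u v)
  · exact .inr (.inl (h.trans hx'))
  · exact .inr (.inl (by omega))

theorem SearchProgress.next_pair (h : SearchProgress φ Imp k (u * n + v) x) (huv : ¬ Imp x u v) :
    SearchProgress φ Imp k (u * n + v + 1) x := by
  refine h.imp_right (.imp_right (.imp_right fun h u' v' hlt => ?_))
  rcases Nat.lt_succ_iff_lt_or_eq.1 hlt with hlt | heq
  · exact h u' v' hlt
  · obtain ⟨rfl, rfl⟩ := index_inj heq
    exact huv

theorem SearchProgress.not_imp (h : SearchProgress φ Imp n 0 x) (hφ : φ x ≤ n) :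
    ¬ Imp x u v := by
  rcases h with h | h | ⟨h, -⟩
  · exact h u v
  all_goals omega

end

/-- Each round with an improvement raises the potential, and a round without one shows that the
search is over. -/
theorem Halts.improve {σ : Type*} (φ : σ → ℕ) (Imp : σ → Fin n → Fin n → Prop)
    (I : σ → State → Prop) (hz : z ≠ 0) (hP : ∀ i, z ≤ i → i ≤ z + 3 → ¬ P.WritesReg i)
    (hP₀ : ¬ P.WritesReg 0) (hn : m.reg 0 = n)
    (hI : ∀ x m i k, z ≤ i → I x m → I x (m.setReg i k)) (hφ₀ : ∀ x m, I x m → 0 < φ x)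
    (hφ : ∀ x m, I x m → φ x ≤ n)
    (h : ∀ x (u v : Fin n) (m' : State), (Program.improve z P).Frame m m' → m'.reg (z + 1) = u →
      m'.reg (z + 2) = v → m'.reg (z + 3) = u * n + v → I x m' → Halts P m' b fun m'' =>
        (Imp x u v ∧ ∃ x', φ x < φ x' ∧ I x' m'') ∨ (¬ Imp x u v ∧ I x m''))
    {x : σ} (hx : I x m) :
    Halts (.improve z P) m (improveCost n b) fun m' => ∃ x, I x m' ∧ ∀ u v, ¬ Imp x u v := by
  have hpairs : ∀ i, (Program.forPairs (z + 1) P).WritesReg i ↔ z + 1 ≤ i ∧ i ≤ z + 3 ∨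
      P.WritesReg i := by
    intro i
    simp only [Program.forPairs, Program.for, Program.WritesReg]
    grind
  refine (Halts.for (fun k m' => ∃ x, I x m' ∧ SearchProgress φ Imp k 0 x) hz
    (by simp [hpairs, hP z]) (by simp [hpairs, hP₀]) hn ?_
    ⟨x, hx, .inr (.inr ⟨hφ₀ x m hx, by simp⟩)⟩ fun k _ m₁ hF₁ _ hI₁ => ?_).post ?_
  · exact fun k m' c ⟨x, hx, hprog⟩ => ⟨x, hI _ _ _ _ le_rfl hx, hprog⟩
  · refine (Halts.forPairs (fun i m' => ∃ x, I x m' ∧ SearchProgress φ Imp k i x) (by simp)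
      (fun i _ _ => hP i (by omega) (by omega)) hP₀ ?_ ?_ hI₁ ?_).post
      fun m' ⟨x, hx, hprog⟩ => ⟨x, hx, hprog.next_round⟩
    · rw [hF₁.reg (by simp [Program.for, Program.WritesReg, hpairs, hP₀, hz.symm]), hn]
    · exact fun i m' j c hj ⟨x, hx, hprog⟩ => ⟨x, hI _ _ _ _ (by omega) hx, hprog⟩
    · rintro u v m₂ hF₂ hu hv hidx ⟨x, hx, hprog⟩
      refine (h x u v m₂ (hF₁.trans hF₂.for) hu hv hidx hx).post ?_
      rintro m₃ (⟨huv, x', hlt, hx'⟩ | ⟨huv, hx⟩)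
      · exact ⟨x', hx', hprog.of_lt huv hlt _⟩
      · exact ⟨x, hx, hprog.next_pair huv⟩
  · exact fun m' ⟨x, hx, hprog⟩ => ⟨x, hx, fun u v => hprog.not_imp (hφ x m' hx)⟩

end Improve

section Encoding

variable {n : ℕ} {G : SimpleGraph (Fin n)} {s t u v : Fin n} {S A B : Finset (Fin n)}
  {P : Program} {m m' : State} {f : ℕ → ℕ}

/-- The state `m` holds the number of vertices of `G` in register `0` and the adjacency matrix of
`G` in array `0`. -/
structure HoldsGraph (G : SimpleGraph (Fin n)) (m : State) : Prop where
  size : m.reg 0 = n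
  adj : ∀ u v : Fin n, m.arr 0 (u * n + v) ≠ 0 ↔ G.Adj u v

theorem HoldsGraph.of_frame (h : HoldsGraph G m) (hF : P.Frame m m') (hreg : ¬ P.WritesReg 0)
    (harr : ¬ P.WritesArr 0) : HoldsGraph G m' :=
  ⟨by rw [hF.reg hreg, h.size], by rw [hF.arr harr]; exact h.adj⟩

/-- The array `f` holds the set `S`: the nonzero cells are those of its members. -/
def HoldsSet (f : ℕ → ℕ) (S : Finset (Fin n)) : Prop := ∀ v : Fin n, f v ≠ 0 ↔ v ∈ S

theorem HoldsSet.insert (h : HoldsSet f S) (v : Fin n) :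
    HoldsSet (Function.update f v 1) (insert v S) := by
  intro w
  have := h w
  simp only [Function.update_apply, Fin.val_inj, Finset.mem_insert]
  grind

theorem HoldsSet.erase (h : HoldsSet f S) (v : Fin n) :
    HoldsSet (Function.update f v 0) (S.erase v) := by
  intro w
  have := h w
  simp only [Function.update_apply, Fin.val_inj, Finset.mem_erase]
  grind

theorem holdsGraph_instanceState : HoldsGraph G (instanceState G s t A B) := by
  refine ⟨rfl, fun u v => ?_⟩
  simp only [instanceState, if_true, ne_eq, ite_eq_right_iff, one_ne_zero, imp_false, not_not]
  refine ⟨?_, fun h => ⟨u, v, h, rfl⟩⟩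
  rintro ⟨x, y, h, hidx⟩
  obtain ⟨rfl, rfl⟩ := index_inj hidx
  exact h

theorem holdsSet_instanceState_left : HoldsSet ((instanceState G s t A B).arr 1) A := by
  simp [HoldsSet, instanceState, Fin.val_inj]

theorem holdsSet_instanceState_right : HoldsSet ((instanceState G s t A B).arr 2) B := by
  simp [HoldsSet, instanceState, Fin.val_inj]

end Encoding

section Reach

variable {n : ℕ} {G : SimpleGraph (Fin n)} {s : Fin n} {S : Finset (Fin n)} {m : State} {a : ℕ}

/-- Compute in array `5` the side of the vertex in register `1` with respect to the set in
array `a`. -/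
def Program.reach (a : ℕ) : Program :=
  .seq (.for 10 (.store 5 (.reg 10) (.const 0))) <| .seq (.store 5 (.reg 1) (.const 1)) <|
    .improve 10 (.when
      (.and (.and (.load 5 (.reg 11)) (.load 0 (.reg 13)))
        (.and (.not (.load a (.reg 12))) (.not (.load 5 (.reg 12)))))
      (.store 5 (.reg 12) (.const 1)))

/-- A bound for the running time of `Program.reach`. -/
def reachCost {R : Type*} [Semiring R] (n : R) : R := forCost n 3 + (3 + improveCost n 38)

theorem Program.reach_writesReg {i : ℕ} : (reach a).WritesReg i ↔ 10 ≤ i ∧ i ≤ 13 := by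
  simp only [reach, improve, forPairs, Program.for, Program.when, WritesReg, or_false, false_or]
  omega

theorem Program.reach_writesArr {b : ℕ} : (reach a).WritesArr b ↔ b = 5 := by
  simp [reach, improve, forPairs, Program.for, Program.when, WritesArr]

theorem halts_clear (hn : m.reg 0 = n) :
    Halts (.for 10 (.store 5 (.reg 10) (.const 0))) m (forCost n 3) fun m' =>
      HoldsSet (m'.arr 5) (∅ : Finset (Fin n)) := by
  refine (Halts.for (fun i m' => ∀ j < i, m'.arr 5 j = 0) (by simp) (by simp [Program.WritesReg])
    (by simp [Program.WritesReg]) hn (fun _ _ _ h => h) (by simp)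
    fun i _ m' _ hi hm' => .store fun j hj => ?_).post fun m' hm' v => by simp [hm' v v.2]
  rcases Nat.lt_succ_iff_lt_or_eq.1 hj with hj | rfl
  · simp [Expr.eval, hi, Function.update_of_ne hj.ne, hm' j hj]
  · simp [Expr.eval, hi]

theorem halts_reach (ha : a ≠ 5) (hm : HoldsGraph G m) (hs : m.reg 1 = s)
    (hS : HoldsSet (m.arr a) S) :
    Halts (.reach a) m (reachCost n) fun m' =>
      ∀ v : Fin n, m'.arr 5 v ≠ 0 ↔ v ∈ sourceSide G s S := by
  refine (halts_clear hm.size).seq fun m₁ hF₁ hm₁ => .store_seq ?_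
  have hs₁ : m₁.reg 1 = s := by rw [hF₁.reg (by simp [Program.for, Program.WritesReg]), hs]
  have hF₂ : (Program.reach a).Frame m (m₁.setArr 5 s 1) :=
    Program.Frame.trans hF₁.seq_left (Program.frame_setArr (Program.reach_writesArr.2 rfl))
  simp only [Expr.eval, hs₁]
  refine (Halts.improve (σ := Finset (Fin n)) Finset.card
    (fun X x y => x ∈ X ∧ G.Adj x y ∧ y ∉ S ∧ y ∉ X)
    (fun X m' => HoldsSet (m'.arr 5) X ∧ s ∈ X ∧ (X : Set (Fin n)) ⊆ sourceSide G s S)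
    (by simp) (by simp [Program.when, Program.WritesReg])
    (by simp [Program.when, Program.WritesReg])
    (by rw [hF₂.reg (by simp [Program.reach_writesReg]), hm.size]) (fun _ _ _ _ _ h => h)
    (fun X _ h => Finset.card_pos.2 ⟨s, h.2.1⟩)
    (fun X _ _ => by simpa using Finset.card_le_univ X) ?_ (x := {s}) ?_).post ?_
  · rintro X x y m₃ hF₃ hx hy hxy ⟨hX, hsX, hsub⟩
    have hF : (Program.reach a).Frame m m₃ := hF₂.trans hF₃.seq_right.seq_right
    have hm₃ := hm.of_frame hF (by simp [Program.reach_writesReg])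
      (by simp [Program.reach_writesArr])
    rw [← hF.arr (by simpa [Program.reach_writesArr] using ha)] at hS
    refine Halts.when (fun htest => .store ?_) fun htest => ?_ <;>
      simp only [Expr.eval, ne_eq, Expr.eval_and_eq_zero, Expr.eval_not_eq_zero, hx, hy, hxy,
        not_not, hX _, hS _, hm₃.adj] at htest
    · obtain ⟨⟨hxX, hadj⟩, hyS, hyX⟩ := htest
      refine .inl ⟨⟨hxX, hadj, hyS, hyX⟩, insert y X, by simp [hyX], ?_, by simp [hsX], ?_⟩
      · simpa [Expr.eval, hy] using hX.insert y
      · rw [Finset.coe_insert, Set.insert_subset_iff]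
        exact ⟨mem_sourceSide_of_adj (hsub hxX) hadj hyS, hsub⟩
    · exact .inr ⟨by tauto, hX, hsX, hsub⟩
  · refine ⟨?_, by simp, by simp [self_mem_sourceSide]⟩
    simpa using hm₁.insert s
  · rintro m₃ ⟨X, ⟨hX, hsX, hsub⟩, hclosed⟩ v
    have hside : sourceSide G s S ⊆ X := sourceSide_subset_of_closed hsX
      fun x hx y hxy hyS => by_contra fun hyX => hclosed x y ⟨hx, hxy, hyS, hyX⟩
    rw [hX v, ← Finset.mem_coe, hsub.antisymm hside]

end Reach

section RecordsJumps

variable {n l : ℕ} {G : SimpleGraph (Fin n)} {s t u v : Fin n} {A S S' : Finset (Fin n)}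
  {f g f' g' : ℕ → ℕ}

/-- The first `l` cells of `f` and `g` hold the sources and the targets of token jumps that lead
from `A` to a given set, through minimum separators. -/
inductive RecordsJumps (G : SimpleGraph (Fin n)) (s t : Fin n) (f g : ℕ → ℕ)
    (A : Finset (Fin n)) : ℕ → Finset (Fin n) → Prop
  | nil : IsMinSeparator G s t A → RecordsJumps G s t f g A 0 A
  | snoc {l : ℕ} {S S' : Finset (Fin n)} {v u : Fin n} : RecordsJumps G s t f g A l S →
      IsMinSeparator G s t S' → IsTokenJump S v u S' → f l = v → g l = u →
        RecordsJumps G s t f g A (l + 1) S'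

theorem RecordsJumps.isMinSeparator (h : RecordsJumps G s t f g A l S) :
    IsMinSeparator G s t S := by
  cases h <;> assumption

theorem RecordsJumps.congr (h : RecordsJumps G s t f g A l S) (hf : ∀ i < l, f' i = f i)
    (hg : ∀ i < l, g' i = g i) : RecordsJumps G s t f' g' A l S := by
  induction h with
  | nil hA => exact .nil hA
  | @snoc l S S' v u _ hS' hjump hv hu ih =>
    exact (ih (fun i hi => hf i (by omega)) fun i hi => hg i (by omega)).snoc hS' hjump
      ((hf l (by omega)).trans hv) ((hg l (by omega)).trans hu)

theorem RecordsJumps.snoc_update (h : RecordsJumps G s t f g A l S) (hS' : IsMinSeparator G s t S')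
    (hjump : IsTokenJump S v u S') :
    RecordsJumps G s t (Function.update f l v) (Function.update g l u) A (l + 1) S' :=
  (h.congr (fun _ hi => Function.update_of_ne hi.ne ..)
    fun _ hi => Function.update_of_ne hi.ne ..).snoc hS' hjump
      (Function.update_self ..) (Function.update_self ..)

theorem RecordsJumps.exists_isJumpSequence (h : RecordsJumps G s t f g A l S) :
    ∃ T : ℕ → Finset (Fin n), IsJumpSequence G s t A S l T ∧ ∀ i < l, ∃ v u : Fin n,
      f i = v ∧ g i = u ∧ IsTokenJump (T i) v u (T (i + 1)) := by
  induction h with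
  | nil hA => exact ⟨fun _ => A, ⟨rfl, rfl, fun _ _ => hA, by simp⟩, by simp⟩
  | @snoc l S S' v u _ hS' hjump hv hu ih =>
    obtain ⟨T, ⟨hT₀, rfl, hmin, -⟩, hT⟩ := ih
    have hold : ∀ i ≤ l, Function.update T (l + 1) S' i = T i :=
      fun i hi => Function.update_of_ne (by omega) ..
    have hjumps : ∀ i < l + 1, ∃ v u : Fin n, f i = v ∧ g i = u ∧ IsTokenJump
        (Function.update T (l + 1) S' i) v u (Function.update T (l + 1) S' (i + 1)) := by
      intro i hi
      rw [hold i (by omega)]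
      rcases Nat.lt_succ_iff_lt_or_eq.1 hi with hi | rfl
      · rw [hold (i + 1) hi]
        exact hT i hi
      · rw [Function.update_self]
        exact ⟨v, u, hv, hu, hjump⟩
    refine ⟨Function.update T (l + 1) S', ⟨by rw [hold 0 (by omega), hT₀],
      Function.update_self .., fun i hi => ?_, fun i hi => ?_⟩, hjumps⟩
    · rcases Nat.le_succ_iff.1 hi with hi | rfl
      · rw [hold i hi]
        exact hmin i hi
      · rwa [Function.update_self]
    · obtain ⟨v, u, -, -, hvu⟩ := hjumps i hi
      exact ⟨v, u, hvu⟩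

theorem RecordsJumps.jumpReconfigurable (h : RecordsJumps G s t f g A l S) :
    JumpReconfigurable G s t A S :=
  let ⟨T, hT, _⟩ := h.exists_isJumpSequence
  ⟨l, T, hT⟩

/-- The first `l` cells of `f` and `g` hold upward jumps that lead from `A` to `S`. As each of them
enlarges the side of `s`, there are fewer of them than vertices on the side of `s` in `G - S`. -/
structure RecordsAscent (G : SimpleGraph (Fin n)) (s t : Fin n) (f g : ℕ → ℕ)
    (A : Finset (Fin n)) (l : ℕ) (S : Finset (Fin n)) : Prop where
  records : RecordsJumps G s t f g A l S
  subset : sourceSide G s A ⊆ sourceSide G s S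
  lt_ncard : l < (sourceSide G s S).ncard

theorem RecordsAscent.nil (hA : IsMinSeparator G s t A) : RecordsAscent G s t f g A 0 A :=
  ⟨.nil hA, subset_rfl, (Set.ncard_pos (Set.toFinite _)).2 ⟨s, self_mem_sourceSide⟩⟩

theorem RecordsAscent.snoc_update (h : RecordsAscent G s t f g A l S)
    (hup : IsUpJump G s t S v u) :
    RecordsAscent G s t (Function.update f l v) (Function.update g l u) A (l + 1) (jump S v u) :=
  have hS := h.records.isMinSeparator
  have hside := hup.sourceSide_ssubset hS
  ⟨h.records.snoc_update (hup.isMinSeparator hS) hup.1, h.subset.trans hside.subset,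
    Nat.succ_le_of_lt h.lt_ncard |>.trans_lt (Set.ncard_lt_ncard hside)⟩

theorem RecordsAscent.isSummit (h : RecordsAscent G s t f g A l S) (hS : IsStuck G s t S) :
    IsSummit G s t A S :=
  ⟨h.records.jumpReconfigurable, h.subset, hS⟩

theorem RecordsAscent.lt_card (h : RecordsAscent G s t f g A l S) : l < n := by
  simpa using h.lt_ncard.trans_le (Set.ncard_le_card _)

end RecordsJumps

section Ascend

variable {n i j a f g c : ℕ} {G : SimpleGraph (Fin n)} {s t u v : Fin n}
  {A S : Finset (Fin n)} {m : State}

/-- The state `m` holds the set `S` in array `a` and an ascent from `A` to `S` in the arrays `f` and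
`g`, with the number of its jumps in register `c`. -/
structure HoldsAscent (G : SimpleGraph (Fin n)) (s t : Fin n) (A : Finset (Fin n))
    (a f g c : ℕ) (S : Finset (Fin n)) (m : State) : Prop where
  holdsSet : HoldsSet (m.arr a) S
  recordsAscent : RecordsAscent G s t (m.arr f) (m.arr g) A (m.reg c) S

/-- Move the token on the vertex in register `i` to the vertex in register `j`, in the set held by
array `a`. -/
def Program.moveToken (a i j : ℕ) : Program :=
  .seq (.store a (.reg i) (.const 0)) (.store a (.reg j) (.const 1))

theorem halts_moveToken (hv : m.reg i = v) (hu : m.reg j = u) (hS : HoldsSet (m.arr a) S) :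
    Halts (.moveToken a i j) m 6 fun m' => HoldsSet (m'.arr a) (jump S v u) := by
  refine .store_seq (.store ?_)
  simpa [Expr.eval, hv, hu, jump_eq_insert_erase] using (hS.erase v).insert u

theorem halts_moveToken_reach (h0a : a ≠ 0) (h5a : a ≠ 5) (hG : HoldsGraph G m) (hs : m.reg 1 = s)
    (hv : m.reg i = v) (hu : m.reg j = u) (hS : HoldsSet (m.arr a) S) :
    Halts (.seq (.moveToken a i j) (.reach a)) m (6 + reachCost n) fun m' =>
      HoldsSet (m'.arr a) (jump S v u) ∧
        ∀ w : Fin n, m'.arr 5 w ≠ 0 ↔ w ∈ sourceSide G s (jump S v u) := by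
  refine (halts_moveToken hv hu hS).seq fun m₁ hF₁ hS₁ => ?_
  have hG₁ := hG.of_frame hF₁ (by simp [Program.moveToken, Program.WritesReg])
    (by simp [Program.moveToken, Program.WritesArr, h0a.symm])
  have hs₁ : m₁.reg 1 = s := by
    rw [hF₁.reg (by simp [Program.moveToken, Program.WritesReg]), hs]
  refine (halts_reach h5a hG₁ hs₁ hS₁).and_frame.post fun m₂ ⟨hF₂, hside⟩ => ⟨?_, hside⟩
  rwa [hF₂.arr (by simp [Program.reach_writesArr, h5a])]

/-- Append the jump from the value of `e` to the value of `e'` to the list of jumps in the arrays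
`f` and `g`, whose length is in register `c`. -/
def Program.appendJump (f g c : ℕ) (e e' : Expr) : Program :=
  .seq (.store f (.reg c) e) <| .seq (.store g (.reg c) e') <|
    .assign c (.add (.reg c) (.const 1))

theorem halts_appendJump {e e' : Expr} (hfg : f ≠ g)
    (he' : ∀ k x, e'.eval (m.setArr f k x) = e'.eval m) :
    Halts (.appendJump f g c e e') m (e.cost + e'.cost + 8) fun m' =>
      m'.arr f = Function.update (m.arr f) (m.reg c) (e.eval m) ∧
        m'.arr g = Function.update (m.arr g) (m.reg c) (e'.eval m) ∧ m'.reg c = m.reg c + 1 := by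
  refine Halts.mono (.store_seq (.store_seq (.assign (Q := fun m' => _ ∧ _ ∧ _) ?_)))
    (by simp only [Expr.cost]; omega) fun _ => id
  simp [Expr.eval, he', hfg, hfg.symm]

/-- After the jump from the vertex in register `7` to the vertex in register `8` and the
computation of the side of `s`: append the jump to the list in the arrays `f` and `g` if it leads
upwards, and undo it otherwise. -/
def Program.commitJump (a f g c : ℕ) : Program :=
  .branch (.and (.load 5 (.reg 7)) (.not (.load 5 (.reg 2))))
    (.appendJump f g c (.reg 7) (.reg 8)) (.moveToken a 8 7)

theorem halts_commitJump (harr : [g, f, a].Nodup) (ht : m.reg 2 = t) (hv : m.reg 7 = v)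
    (hu : m.reg 8 = u) (hvS : v ∈ S) (huS : u ∉ S) (hS : HoldsSet (m.arr a) (jump S v u))
    (hside : ∀ w : Fin n, m.arr 5 w ≠ 0 ↔ w ∈ sourceSide G s (jump S v u))
    (hup : IsUpJump G s t S v u ↔
      v ∈ sourceSide G s (jump S v u) ∧ t ∉ sourceSide G s (jump S v u))
    (hA : RecordsAscent G s t (m.arr f) (m.arr g) A (m.reg c) S) :
    Halts (.commitJump a f g c) m 30 fun m' =>
      (IsUpJump G s t S v u ∧ HoldsAscent G s t A a f g c (jump S v u) m') ∨
        (¬ IsUpJump G s t S v u ∧ HoldsAscent G s t A a f g c S m') := by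
  simp only [List.nodup_cons, List.mem_cons, List.not_mem_nil, not_or, or_false] at harr
  obtain ⟨⟨hgf, hga⟩, hfa, -⟩ := harr
  refine Halts.branch (b₁ := 10) (b₂ := 6) (fun htest => ?_) fun htest => ?_ <;>
    simp only [ne_eq, Expr.eval_and_eq_zero, Expr.eval_not_eq_zero, Expr.eval, hv, ht, not_not,
      hside _, ← hup] at htest
  · refine (halts_appendJump (Ne.symm hgf) fun _ _ => rfl).and_frame.post
      fun m' ⟨hF, hf, hg, hc⟩ => .inl ?_
    refine ⟨htest, ?_, ?_⟩
    · rwa [hF.arr (by simp [Program.appendJump, Program.WritesArr, Ne.symm hfa, Ne.symm hga])]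
    · simpa only [hf, hg, hc, Expr.eval, hv, hu] using hA.snoc_update htest
  · refine (halts_moveToken hu hv hS).and_frame.post fun m' ⟨hF, hS'⟩ => .inr ⟨htest, ?_⟩
    rw [jump_jump hvS huS] at hS'
    refine ⟨hS', ?_⟩
    rwa [hF.arr (a := f), hF.arr (a := g), hF.reg]
    all_goals simp [Program.moveToken, Program.WritesReg, Program.WritesArr, *]

/-- If the jump from the vertex in register `7` to the vertex in register `8` leads upwards from
the set in array `a`, then perform it and append it to the list of jumps in the arrays `f` and `g`,
whose length is in register `c`. -/
def Program.tryJump (a f g c : ℕ) : Program :=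
  .when (.and (.and (.load a (.reg 7)) (.not (.load a (.reg 8))))
      (.and (.not (.eq (.reg 8) (.reg 1))) (.not (.eq (.reg 8) (.reg 2)))))
    (.seq (.seq (.moveToken a 7 8) (.reach a)) (.commitJump a f g c))

/-- A bound for the running time of `Program.tryJump`. -/
def tryJumpCost {R : Type*} [Semiring R] (n : R) : R := reachCost n + 87

theorem Program.tryJump_writesReg : (tryJump a f g c).WritesReg i ↔ i = c ∨ 10 ≤ i ∧ i ≤ 13 := by
  simp only [tryJump, moveToken, commitJump, appendJump, Program.when, WritesReg, reach_writesReg]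
  tauto

theorem Program.tryJump_writesArr :
    (tryJump a f g c).WritesArr i ↔ i = a ∨ i = 5 ∨ i = f ∨ i = g := by
  simp only [tryJump, moveToken, commitJump, appendJump, Program.when, WritesArr, reach_writesArr]
  tauto

theorem halts_tryJump (harr : [g, f, a, 5, 0].Nodup) (hc : c < 10)
    (hG : HoldsGraph G m) (hs : m.reg 1 = s) (ht : m.reg 2 = t) (hv : m.reg 7 = v)
    (hu : m.reg 8 = u) (hm : HoldsAscent G s t A a f g c S m) :
    Halts (.tryJump a f g c) m (tryJumpCost n) fun m' =>
      (IsUpJump G s t S v u ∧ HoldsAscent G s t A a f g c (jump S v u) m') ∨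
        (¬ IsUpJump G s t S v u ∧ HoldsAscent G s t A a f g c S m') := by
  obtain ⟨hS, hA⟩ := id hm
  have hup := isUpJump_iff (u := u) (v := v) hA.records.isMinSeparator.1
  have harr' := harr
  simp only [List.nodup_cons, List.mem_cons, List.not_mem_nil, not_or, or_false] at harr'
  obtain ⟨⟨-, hga, hg5, -⟩, ⟨hfa, hf5, -⟩, ⟨ha5, ha0⟩, -⟩ := harr'
  refine (Halts.when (b := 6 + reachCost n + 30) (fun htest => ?_) fun htest => ?_).mono ?_
    fun _ => id
  · simp only [ne_eq, Expr.eval_and_eq_zero, Expr.eval_not_eq_zero, Expr.eval_eq_eq_zero,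
      Expr.eval, hv, hu, hs, ht, not_not, hS _, Fin.val_inj] at htest
    refine (halts_moveToken_reach ha0 ha5 hG hs hv hu hS).seq fun m₁ hF ⟨hS₁, hside⟩ => ?_
    have hreg : ∀ i < 10, m₁.reg i = m.reg i := fun i hi =>
      hF.reg (by simp [Program.moveToken, Program.WritesReg, Program.reach_writesReg, hi])
    have harr₁ : ∀ i, i ≠ a → i ≠ 5 → m₁.arr i = m.arr i := fun i hia hi5 =>
      hF.arr (by simp [Program.moveToken, Program.WritesArr, Program.reach_writesArr, hia, hi5])
    refine halts_commitJump (harr.sublist (List.prefix_append [g, f, a] _).sublist)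
      (by rw [hreg 2 (by simp), ht]) (by rw [hreg 7 (by simp), hv])
      (by rw [hreg 8 (by simp), hu]) htest.1.1 htest.1.2 hS₁ hside
      (hup.trans (and_iff_right htest)) ?_
    rwa [harr₁ f hfa hf5, harr₁ g hga hg5, hreg c hc]
  · simp only [ne_eq, Expr.eval_and_eq_zero, Expr.eval_not_eq_zero, Expr.eval_eq_eq_zero,
      Expr.eval, hv, hu, hs, ht, not_not, hS _, Fin.val_inj] at htest
    exact .inr ⟨fun h => htest (hup.1 h).1, hm⟩
  · simp only [Expr.cost, Expr.and, Expr.eq, Expr.not, tryJumpCost]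
    omega

/-- Perform upward jumps, starting from the set in array `a`, until it is stuck, and list them in
the arrays `f` and `g`, with their number in register `c`. -/
def Program.ascend (a f g c : ℕ) : Program :=
  .seq (.assign c (.const 0)) (.improve 6 (.tryJump a f g c))

/-- A bound for the running time of `Program.ascend`. -/
def ascendCost {R : Type*} [Semiring R] (n : R) : R := 2 + improveCost n (tryJumpCost n)

theorem Program.ascend_writesReg : (ascend a f g c).WritesReg i ↔ i = c ∨ 6 ≤ i ∧ i ≤ 13 := by
  simp only [ascend, improve, forPairs, Program.for, WritesReg, tryJump_writesReg]
  omega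

theorem Program.ascend_writesArr :
    (ascend a f g c).WritesArr i ↔ i = a ∨ i = 5 ∨ i = f ∨ i = g := by
  simp only [ascend, improve, forPairs, Program.for, WritesArr, tryJump_writesArr, false_or,
    or_false]

theorem halts_ascend (harr : [g, f, a, 5, 0].Nodup) (hc : 3 ≤ c) (hc' : c < 6)
    (hG : HoldsGraph G m) (hs : m.reg 1 = s) (ht : m.reg 2 = t) (hA : IsMinSeparator G s t A)
    (hset : HoldsSet (m.arr a) A) :
    Halts (.ascend a f g c) m (ascendCost n) fun m' =>
      ∃ S, HoldsAscent G s t A a f g c S m' ∧ IsStuck G s t S := by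
  have hreg : ∀ i < 3, ¬ (Program.ascend a f g c).WritesReg i := fun i hi => by
    rw [Program.ascend_writesReg]
    omega
  have harr₀ : ¬ (Program.ascend a f g c).WritesArr 0 := by
    simp only [List.nodup_cons, List.mem_cons] at harr
    rw [Program.ascend_writesArr]
    tauto
  refine .assign_seq <| Halts.improve (fun S : Finset (Fin n) => (sourceSide G s S).ncard)
    (IsUpJump G s t) (HoldsAscent G s t A a f g c) (by simp)
    (fun i _ _ => by rw [Program.tryJump_writesReg]; omega)
    (by rw [Program.tryJump_writesReg]; omega) (by simp [hG.size, show 0 ≠ c by omega]) ?_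
    (fun S _ h => Nat.zero_lt_of_lt h.recordsAscent.lt_ncard)
    (fun S _ _ => by simpa using Set.ncard_le_card (sourceSide G s (S : Set (Fin n)))) ?_
    (x := A) ⟨hset, ?_⟩
  · rintro S m' i k hi ⟨hS, hrec⟩
    exact ⟨hS, by simpa [show c ≠ i by omega] using hrec⟩
  · intro S v u m' hF hv hu _ hm'
    have hF : (Program.ascend a f g c).Frame m m' :=
      (Program.frame_setReg (Program.ascend_writesReg.2 (.inl rfl))).trans hF.seq_right
    refine (halts_tryJump harr (by omega) (hG.of_frame hF (hreg 0 (by simp)) harr₀)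
      (by rw [hF.reg (hreg 1 (by simp)), hs]) (by rw [hF.reg (hreg 2 (by simp)), ht]) hv hu
      hm').post fun m'' h => h.imp_left fun ⟨hup, hm''⟩ => ⟨hup, _, ?_, hm''⟩
    exact Set.ncard_lt_ncard (hup.sourceSide_ssubset hm'.recordsAscent.records.isMinSeparator)
  · simpa [Expr.eval] using .nil hA

end Ascend

section Reconfigure

variable {n : ℕ} {G : SimpleGraph (Fin n)} {s t : Fin n} {A B M N : Finset (Fin n)} {m : State}

/-- Set register `5` to a truth value that says whether the arrays `1` and `2` hold the same set. -/
def Program.compare : Program :=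
  .seq (.assign 5 (.const 1)) <|
    .for 6 (.assign 5 (.and (.reg 5) (.iff (.load 1 (.reg 6)) (.load 2 (.reg 6)))))

/-- A bound for the running time of `Program.compare`. -/
def compareCost {R : Type*} [Semiring R] (n : R) : R := 2 + forCost n 30

theorem halts_compare (hn : m.reg 0 = n) (hM : HoldsSet (m.arr 1) M) (hN : HoldsSet (m.arr 2) N) :
    Halts .compare m (compareCost n) fun m' => m'.reg 5 ≠ 0 ↔ M = N := by
  refine .assign_seq <| (Halts.for
    (fun i m' => m'.reg 5 ≠ 0 ↔ ∀ v : Fin n, v < i → (v ∈ M ↔ v ∈ N)) (by simp)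
    (by simp [Program.WritesReg]) (by simp [Program.WritesReg]) (by simp [hn])
    (fun i m' x h => by simpa using h) (by simp [Expr.eval]) fun i hi m' hF hi' hm' => ?_).post ?_
  · have harr : ∀ a, m'.arr a = m.arr a := fun a =>
      hF.arr (by simp [Program.for, Program.WritesArr])
    refine .assign ?_
    have hstep : (∀ v : Fin n, v < i + 1 → (v ∈ M ↔ v ∈ N)) ↔
        (∀ v : Fin n, v < i → (v ∈ M ↔ v ∈ N)) ∧ (⟨i, hi⟩ ∈ M ↔ ⟨i, hi⟩ ∈ N) := by
      simp only [Nat.lt_succ_iff_lt_or_eq, or_imp, forall_and, and_congr_right_iff]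
      exact fun _ => ⟨fun h => h _ rfl, fun h v hv => by
        obtain rfl : v = ⟨i, hi⟩ := Fin.ext hv
        exact h⟩
    rw [hstep, ← hm', ← hM, ← hN]
    simp [Expr.eval, hi', harr]
  · intro m' hm'
    simp [hm', Finset.ext_iff]

/-- Append the jumps that are listed in the arrays `6` and `7` to the jumps that are listed in the
arrays `3` and `4`, in reverse order and with sources and targets exchanged. -/
def Program.appendReverse : Program :=
  .loop (.reg 4) <| .seq (.assign 4 (.sub (.reg 4) (.const 1))) <|
    .appendJump 3 4 3 (.load 7 (.reg 4)) (.load 6 (.reg 4))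

/-- A bound for the running time of `Program.appendReverse`. -/
def appendReverseCost {R : Type*} [Semiring R] (n : R) : R := n * 18 + 2

theorem halts_appendReverse (hA : RecordsJumps G s t (m.arr 3) (m.arr 4) A (m.reg 3) M)
    (hB : RecordsJumps G s t (m.arr 6) (m.arr 7) B (m.reg 4) M) (hn : m.reg 4 ≤ n) :
    Halts .appendReverse m (appendReverseCost n) fun m' =>
      RecordsJumps G s t (m'.arr 3) (m'.arr 4) A (m'.reg 3) B := by
  refine (Halts.loop (e := .reg 4) (b := 16) (fun k m' => m'.reg 4 = k ∧ ∃ S,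
    RecordsJumps G s t (m'.arr 3) (m'.arr 4) A (m'.reg 3) S ∧
      RecordsJumps G s t (m'.arr 6) (m'.arr 7) B k S) (fun m' h => h.1) ?_ ⟨rfl, M, hA, hB⟩).mono
    ?_ ?_
  · rintro k m₁ ⟨hk, S, hA, hB⟩
    cases hB with
    | @snoc _ S' _ v u hB _ hjump hv hu =>
      refine ⟨by simp [Expr.eval, hk], .assign_seq <| (halts_appendJump (f := 3) (g := 4) (c := 3)
        (e := .load 7 (.reg 4)) (e' := .load 6 (.reg 4)) (by simp) fun _ _ => by
          simp [Expr.eval]).and_frame.post fun m₂ ⟨hF, h₃, h₄, hlen⟩ => ⟨?_, S', ?_, ?_⟩⟩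
      · rw [hF.reg (by simp [Program.appendJump, Program.WritesReg])]
        simp [Expr.eval, hk]
      · rw [h₃, h₄, hlen]
        simpa [Expr.eval, hk, hv, hu] using hA.snoc_update hB.isMinSeparator hjump.symm
      · rwa [hF.arr (a := 6) (by simp [Program.appendJump, Program.WritesArr]),
          hF.arr (a := 7) (by simp [Program.appendJump, Program.WritesArr])]
  · simpa [Expr.cost, appendReverseCost] using Nat.mul_le_mul_right 18 hn
  · rintro m' ⟨-, S, hA, hB⟩
    cases hB with
    | nil => exact hA

/-- Ascend from both given sets. -/
def Program.ascendBoth : Program := .seq (.ascend 1 3 4 3) (.ascend 2 6 7 4)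

theorem halts_ascendBoth (hA : IsMinSeparator G s t A) (hB : IsMinSeparator G s t B) :
    Halts .ascendBoth (instanceState G s t A B) (ascendCost n + ascendCost n) fun m' =>
      m'.reg 0 = n ∧ ∃ M N, HoldsAscent G s t A 1 3 4 3 M m' ∧ HoldsAscent G s t B 2 6 7 4 N m' ∧
        IsStuck G s t M ∧ IsStuck G s t N := by
  refine (halts_ascend (by decide) (by simp) (by simp) holdsGraph_instanceState rfl rfl hA
    holdsSet_instanceState_left).seq fun m₁ hF₁ ⟨M, hM, hMstuck⟩ => ?_
  have hreg₁ : ∀ i < 3, m₁.reg i = (instanceState G s t A B).reg i := fun i hi =>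
    hF₁.reg (by rw [Program.ascend_writesReg]; omega)
  have harr₁ : ∀ i, i = 0 ∨ i = 2 → m₁.arr i = (instanceState G s t A B).arr i := fun i hi =>
    hF₁.arr (by rw [Program.ascend_writesArr]; omega)
  refine (halts_ascend (by decide) (by simp) (by simp)
    (holdsGraph_instanceState.of_frame hF₁ (by simp [Program.ascend_writesReg])
      (by simp [Program.ascend_writesArr])) (hreg₁ 1 (by simp)) (hreg₁ 2 (by simp)) hB
    (by rw [harr₁ 2 (by simp)]; exact holdsSet_instanceState_right)).and_frame.post
      fun m₂ ⟨hF₂, N, hN, hNstuck⟩ => ?_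
  have hreg₂ : ∀ i < 4, m₂.reg i = m₁.reg i := fun i hi =>
    hF₂.reg (by rw [Program.ascend_writesReg]; omega)
  have harr₂ : ∀ i, i = 1 ∨ i = 3 ∨ i = 4 → m₂.arr i = m₁.arr i := fun i hi =>
    hF₂.arr (by rw [Program.ascend_writesArr]; omega)
  refine ⟨by rw [hreg₂ 0 (by simp), hreg₁ 0 (by simp)]; rfl, M, N, ⟨?_, ?_⟩, hN, hMstuck, hNstuck⟩
  · rw [harr₂ 1 (by simp)]
    exact hM.holdsSet
  · rw [harr₂ 3 (by simp), harr₂ 4 (by simp), hreg₂ 3 (by simp)]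
    exact hM.recordsAscent

/-- Decide reconfigurability by a comparison of the two sets in which the ascents end, and answer
with the first ascent followed by the reverse of the second one. -/
def Program.reconfigure : Program :=
  .seq .ascendBoth <| .seq .compare <| .branch (.reg 5)
    (.seq .appendReverse <| .seq (.assign 1 (.reg 3)) <| .assign 0 (.const 1))
    (.assign 0 (.const 0))

/-- A bound for the running time of `Program.reconfigure`. -/
def reconfigureCost {R : Type*} [Semiring R] (n : R) : R :=
  ascendCost n + ascendCost n + (compareCost n + (2 + (appendReverseCost n + 4 + 2)))

theorem eval_reconfigureCost_X :
    (reconfigureCost (.X : Polynomial ℕ)).eval n = reconfigureCost n := by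
  simp [reconfigureCost, ascendCost, compareCost, appendReverseCost, tryJumpCost, reachCost,
    improveCost, forPairsCost, forCost]

theorem halts_reconfigure (hA : IsMinSeparator G s t A) (hB : IsMinSeparator G s t B) :
    Halts .reconfigure (instanceState G s t A B) (reconfigureCost n) fun m' =>
      (JumpReconfigurable G s t A B → AnswersYesWithWitness G s t A B m') ∧
        (¬ JumpReconfigurable G s t A B → AnswersNo m') := by
  refine (halts_ascendBoth hA hB).seq fun m₁ _ ⟨hn, M, N, hM, hN, hMstuck, hNstuck⟩ => ?_
  have heq_of_reconf : JumpReconfigurable G s t A B → M = N :=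
    (hM.recordsAscent.isSummit hMstuck).eq_of_jumpReconfigurable (hN.recordsAscent.isSummit hNstuck)
  refine (halts_compare hn hM.holdsSet hN.holdsSet).seq fun m₂ hF heq => ?_
  have hreg : ∀ i, i = 3 ∨ i = 4 → m₂.reg i = m₁.reg i := fun i hi =>
    hF.reg (by simp only [Program.compare, Program.for, Program.WritesReg]; omega)
  have harr : ∀ i, m₂.arr i = m₁.arr i := fun i =>
    hF.arr (by simp [Program.compare, Program.for, Program.WritesArr])
  refine Halts.branch (b₁ := appendReverseCost n + 4) (fun htest => ?_) fun htest => .assign ?_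
  · have hrecB := hN.recordsAscent.records
    rw [← heq.1 htest] at hrecB
    refine (halts_appendReverse (A := A) (B := B) (M := M) ?_ ?_ ?_).seq fun m₃ _ hrec =>
      .assign_seq (.assign ⟨fun _ => ⟨by simp [Expr.eval], ?_⟩, absurd hrec.jumpReconfigurable⟩)
    · rw [harr, harr, hreg 3 (by simp)]
      exact hM.recordsAscent.records
    · rwa [harr, harr, hreg 4 (by simp)]
    · rw [hreg 4 (by simp)]
      exact hN.recordsAscent.lt_card.le
    · simpa [Expr.eval] using hrec.exists_isJumpSequence
  · exact ⟨fun h => absurd (heq_of_reconf h) (mt heq.2 (not_not.2 htest)),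
      fun _ => by simp [AnswersNo, Expr.eval]⟩

end Reconfigure

end RAM

/-- One fixed program, with a running time polynomial in the number `n` of vertices, decides for
all finite graphs `G`, vertices `s`, `t` and minimum `s`-`t`-separators `A`, `B` whether `A` can be
reconfigured into `B` by token jumps, and outputs a sequence of jumps when it can. -/
theorem mainTheorem6 :
    ∃ (P : RAM.Program) (p : Polynomial ℕ),
      ∀ (n : ℕ) (G : SimpleGraph (Fin n)) (s t : Fin n) (A B : Finset (Fin n)),
        IsMinSeparator G s t A → IsMinSeparator G s t B →
          ∃ (T : ℕ) (m : RAM.State),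
            RAM.Run P (instanceState G s t A B) T m ∧ T ≤ p.eval n ∧
              (JumpReconfigurable G s t A B → AnswersYesWithWitness G s t A B m) ∧
              (¬ JumpReconfigurable G s t A B → AnswersNo m) := by
  refine ⟨.reconfigure, RAM.reconfigureCost .X, fun n G s t A B hA hB => ?_⟩
  rw [RAM.eval_reconfigureCost_X]
  exact RAM.halts_reconfigure hA hB
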